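/- Let $(X_1,d_1,T_1)$ and $(X_2,d_2,T_2)$ be topological dynamical systems, i.e. $(X_i,d_i)$ is a compact metric space and $T_i\colon X_i\to X_i$ is continuous. Equip $X_1\times X_2$ with the map $T_1\times T_2$ and the metric $\rho((x_1,x_2),(y_1,y_2))=\max\{d_1(x_1,y_1),d_2(x_2,y_2)\}$. For a topological dynamical system $(X,d,T)$ let $d_n(x,y)=\max_{0\le k<n}d(T^kx,T^ky)$ and $B_n(x,\epsilon)=\{y\in X: d_n(x,y)<\epsilon\}$. For $Z\subset X$, $s\ge 0$, $N\in\mathbb N$ and $\epsilon>0$ let $$\mathcal M^s_{N,\epsilon}(Z)=\inf\sum_i e^{-sn_i},$$ where the infimum is over all finite or countable families $\{B_{n_i}(x_i,\epsilon)\}$ with $x_i\in X$, $n_i\ge N$ and $Z\subset\bigcup_iB_{n_i}(x_i,\epsilon)$. Let $\mathcal M^s(Z)=\lim_{\epsilon\to0}\lim_{N\to\infty}\mathcal M^s_{N,\epsilon}(Z)$. Bowen's topological entropy $h^B(Z)\in[0,\infty]$ is the critical value at which $\mathcal M^s(Z)$ jumps from $\infty$ to $0$, i.e. $h^B(Z)=\inf\{s\ge0:\mathcal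 M^s(Z)=0\}$, with $\inf\emptyset=\infty$. Let $Z_1\subset X_1$ and $Z_2\subset X_2$ be analytic sets, that is, continuous images of $\mathbb N^{\mathbb N}$ (in particular non-empty). Suppose that for $i=1$ or for $i=2$ the set $Z_i$ is compact and $T_i$-invariant, meaning $T_i(Z_i)\subset Z_i$. Then $$h^B(Z_1\times Z_2)=h^B(Z_1)+h^B(Z_2)$$ as an equality in $[0,\infty]$, where $h^B(Z_1\times Z_2)$ is computed in the system $(X_1\times X_2,\rho,T_1\times T_2)$. -/

import Mathlib

open Set Filter Topology
open scoped NNReal ENNReal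

noncomputable section

namespace BowenEntropy

variable {X : Type*} [MetricSpace X]

/-- The `n`-th Bowen metric `d_n(x,y) = max {d(T^k x, T^k y) : 0 ≤ k < n}`
(equal to `0` for `n = 0`). -/
def bowenDist (T : X → X) (n : ℕ) (x y : X) : ℝ :=
  ⨆ k : Fin n, dist (T^[k] x) (T^[k] y)

/-- The open Bowen ball `B_n(x, ε) = {y : d_n(x,y) < ε}`. -/
def bowenBall (T : X → X) (n : ℕ) (x : X) (ε : ℝ) : Set X :=
  {y | bowenDist T n x y < ε}

/-- `M^s_{N,ε}(Z)`: the infimum of `∑ exp(-s n_i)` over all finite or countable families of Bowen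
balls `B_{n_i}(x_i, ε)` with `x_i ∈ X` and `n_i ≥ N` that cover `Z`. A family is given by the
countable set of its pairs `(x_i, n_i)`. -/
def coverSum (T : X → X) (s : ℝ≥0) (N : ℕ) (ε : ℝ) (Z : Set X) : ℝ≥0∞ :=
  ⨅ (C : Set (X × ℕ)) (_ : C.Countable) (_ : ∀ p ∈ C, N ≤ p.2)
    (_ : Z ⊆ ⋃ p ∈ C, bowenBall T p.2 p.1 ε),
    ∑' p : C, ENNReal.ofReal (Real.exp (-((s : ℝ) * ((p : X × ℕ).2 : ℝ))))

/-- `M^s_ε(Z) = lim_{N → ∞} M^s_{N,ε}(Z)`, an increasing limit. -/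
def coverMeasureAt (T : X → X) (s : ℝ≥0) (ε : ℝ) (Z : Set X) : ℝ≥0∞ :=
  ⨆ N : ℕ, coverSum T s N ε Z

/-- `M^s(Z) = lim_{ε → 0+} M^s_ε(Z)`, an increasing limit as `ε` decreases. -/
def coverMeasure (T : X → X) (s : ℝ≥0) (Z : Set X) : ℝ≥0∞ :=
  ⨆ (ε : ℝ) (_ : 0 < ε), coverMeasureAt T s ε Z

/-- Bowen's topological entropy `h^B(Z) ∈ [0, ∞]`: the critical value of `s ≥ 0` at which
`M^s(Z)` jumps from `∞` to `0` (it is `∞` if `M^s(Z)` never vanishes). -/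
def bowenEntropy (T : X → X) (Z : Set X) : ℝ≥0∞ :=
  ⨅ (s : ℝ≥0) (_ : coverMeasure T s Z = 0), (s : ℝ≥0∞)

theorem mem_bowenBall_iff (T : X → X) (n : ℕ) (x y : X) {ε : ℝ} (hε : 0 < ε) :
    y ∈ bowenBall T n x ε ↔ ∀ k < n, dist (T^[k] x) (T^[k] y) < ε := by
  unfold bowenBall bowenDist
  rcases Nat.eq_zero_or_pos n with rfl | hn
  · simp [hε]
  · have : Nonempty (Fin n) := ⟨⟨0, hn⟩⟩
    refine ⟨fun h k hk => ?_, fun h => ?_⟩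
    · exact (le_ciSup (f := fun k : Fin n => dist (T^[k] x) (T^[k] y))
        (Set.finite_range _).bddAbove ⟨k, hk⟩).trans_lt h
    · obtain ⟨k, hk⟩ := exists_eq_ciSup_of_finite (f := fun k : Fin n => dist (T^[k] x) (T^[k] y))
      change (⨆ k : Fin n, dist (T^[k] x) (T^[k] y)) < ε
      rw [← hk]
      exact h k k.2

theorem coverSum_mono_left (T : X → X) (s : ℝ≥0) (ε : ℝ) (Z : Set X) :
    Monotone fun N => coverSum T s N ε Z := by
  intro N M h
  refine le_iInf fun C => le_iInf fun h1 => le_iInf fun h2 => le_iInf fun h3 => ?_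
  exact iInf_le_of_le C (iInf_le_of_le h1 (iInf_le_of_le (fun p hp => h.trans (h2 p hp))
    (iInf_le_of_le h3 le_rfl)))

theorem coverSum_antitone (T : X → X) (s : ℝ≥0) (N : ℕ) (Z : Set X) :
    Antitone fun ε => coverSum T s N ε Z := by
  intro a b h
  refine le_iInf fun C => le_iInf fun h1 => le_iInf fun h2 => le_iInf fun h3 => ?_
  refine iInf_le_of_le C (iInf_le_of_le h1 (iInf_le_of_le h2
    (iInf_le_of_le (h3.trans ?_) le_rfl)))
  exact iUnion₂_mono fun p _ y (hy : _ < a) => lt_of_lt_of_le hy h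

/-- The supremum over `N` is the limit as `N → ∞`. -/
theorem tendsto_coverSum (T : X → X) (s : ℝ≥0) (ε : ℝ) (Z : Set X) :
    Tendsto (fun N => coverSum T s N ε Z) atTop (𝓝 (coverMeasureAt T s ε Z)) :=
  tendsto_atTop_iSup (coverSum_mono_left T s ε Z)

/-- The supremum over `ε > 0` is the limit as `ε → 0+`. -/
theorem tendsto_coverMeasureAt (T : X → X) (s : ℝ≥0) (Z : Set X) :
    Tendsto (fun ε => coverMeasureAt T s ε Z) (𝓝[>] 0) (𝓝 (coverMeasure T s Z)) := by
  have h : Antitone fun ε => coverMeasureAt T s ε Z := fun a b hab =>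
    iSup_mono fun N => coverSum_antitone T s N Z hab
  have := h.tendsto_nhdsGT (0 : ℝ)
  rwa [sSup_image] at this

theorem coverSum_le_mul (T : X → X) {s t : ℝ≥0} (hst : s ≤ t) (N : ℕ) (ε : ℝ) (Z : Set X) :
    coverSum T t N ε Z ≤
      ENNReal.ofReal (Real.exp (-(((t : ℝ) - s) * N))) * coverSum T s N ε Z := by
  have hc0 : ENNReal.ofReal (Real.exp (-(((t : ℝ) - s) * N))) ≠ 0 := by
    simp [Real.exp_pos]
  unfold coverSum
  simp_rw [ENNReal.mul_iInf_of_ne hc0 ENNReal.ofReal_ne_top]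
  refine iInf_mono fun C => iInf_mono fun h1 => iInf_mono fun h2 => iInf_mono fun h3 => ?_
  rw [← ENNReal.tsum_mul_left]
  refine ENNReal.tsum_le_tsum fun p => ?_
  rw [← ENNReal.ofReal_mul (Real.exp_pos _).le, ← Real.exp_add]
  refine ENNReal.ofReal_le_ofReal (Real.exp_le_exp.2 ?_)
  have hN : (N : ℝ) ≤ ((p : X × ℕ).2 : ℝ) := by exact_mod_cast h2 p p.2
  have hs : (s : ℝ) ≤ t := by exact_mod_cast hst
  nlinarith [mul_le_mul_of_nonneg_left hN (sub_nonneg.2 hs)]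

theorem coverMeasure_eq_zero_of_lt (T : X → X) {s t : ℝ≥0} (hst : s < t) {Z : Set X}
    (h : coverMeasure T s Z ≠ ∞) : coverMeasure T t Z = 0 := by
  unfold coverMeasure
  simp only [ENNReal.iSup_eq_zero]
  intro ε hε
  have hfin : coverMeasureAt T s ε Z ≠ ∞ := ne_top_of_le_ne_top h
    (le_iSup₂ (f := fun (ε : ℝ) (_ : 0 < ε) => coverMeasureAt T s ε Z) ε hε)
  have hts : (0 : ℝ) < (t : ℝ) - s := sub_pos.2 (by exact_mod_cast hst)
  have hlim : Tendsto (fun N : ℕ => ENNReal.ofReal (Real.exp (-(((t : ℝ) - s) * N))) *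
      coverMeasureAt T s ε Z) atTop (𝓝 (0 * coverMeasureAt T s ε Z)) := by
    refine ENNReal.Tendsto.mul_const ?_ (Or.inr hfin)
    rw [← ENNReal.ofReal_zero]
    refine ENNReal.tendsto_ofReal (Real.tendsto_exp_neg_atTop_nhds_zero.comp ?_)
    exact tendsto_natCast_atTop_atTop.const_mul_atTop hts
  rw [zero_mul] at hlim
  refine le_antisymm (le_of_tendsto_of_tendsto' (tendsto_coverSum T t ε Z) hlim fun N => ?_)
    zero_le
  refine (coverSum_le_mul T hst.le N ε Z).trans ?_
  gcongr
  exact le_iSup (fun N => coverSum T s N ε Z) N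

/-- `M^s(Z) = 0` for `s > h^B(Z)`. -/
theorem coverMeasure_eq_zero (T : X → X) {s : ℝ≥0} {Z : Set X}
    (h : bowenEntropy T Z < s) : coverMeasure T s Z = 0 := by
  simp only [bowenEntropy, iInf_lt_iff] at h
  obtain ⟨t, ht, hts⟩ := h
  exact coverMeasure_eq_zero_of_lt T (by exact_mod_cast hts) (by simp [ht])

/-- `M^s(Z) = ∞` for `s < h^B(Z)`. -/
theorem coverMeasure_eq_top (T : X → X) {s : ℝ≥0} {Z : Set X}
    (h : (s : ℝ≥0∞) < bowenEntropy T Z) : coverMeasure T s Z = ∞ := by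
  by_contra hne
  obtain ⟨t, hst, htZ⟩ := ENNReal.lt_iff_exists_nnreal_btwn.1 h
  have h0 := coverMeasure_eq_zero_of_lt T (ENNReal.coe_lt_coe.1 hst) hne
  exact absurd (iInf₂_le (f := fun (s : ℝ≥0) (_ : coverMeasure T s Z = 0) => (s : ℝ≥0∞)) t h0)
    (not_le.2 htZ)

end BowenEntropy

end

/-! The two inequalities rest on different mechanisms. Lower bound: a cover of `Z ×ˢ W` by Bowen
balls of orders `n_i`, sliced over a point `z` of `Z`, covers `W`, so the weights `exp(-t n_i)` of
the balls whose first factor contains `z` sum to at least the cover sum of `W`. The first factors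
thus form a weighted cover of `Z`. By `coverSum_mul_le_tsum_weights` such a cover can be traded for
a genuine one, at the price of a doubled radius and a small loss `δ` in the exponent. Upper bound:
on a compact invariant `W`, compactness gives a finite cover with weights summing to at most `1`,
and invariance lets it be applied again along orbits. Hence `exists_finset_centers_of_invariant`: at
most `C exp(t n)` balls of order `n` cover `W`, for every `n`. Multiplying each ball of a cover of
`Z` by such a family of its own order costs only the factor `C`. -/

namespace BowenEntropy

/-! ### Exponential weights -/

section Weights

/-- The weight `exp(-s n)` of a Bowen ball of order `n`. -/
noncomputable def ballWeight (s : ℝ≥0) (n : ℕ) : ℝ≥0∞ := ENNReal.ofReal (Real.exp (-((s : ℝ) * (n : ℝ))))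

theorem ballWeight_ne_zero (s : ℝ≥0) (n : ℕ) : ballWeight s n ≠ 0 := by
  simp [ballWeight, Real.exp_pos]

theorem ballWeight_ne_top (s : ℝ≥0) (n : ℕ) : ballWeight s n ≠ ∞ := ENNReal.ofReal_ne_top

theorem ballWeight_add_left (s t : ℝ≥0) (n : ℕ) :
    ballWeight (s + t) n = ballWeight s n * ballWeight t n := by
  rw [ballWeight, ballWeight, ballWeight, ← ENNReal.ofReal_mul (Real.exp_pos _).le, ← Real.exp_add]
  congr 2
  push_cast
  ring

theorem ballWeight_add_right (s : ℝ≥0) (m n : ℕ) :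
    ballWeight s (m + n) = ballWeight s m * ballWeight s n := by
  rw [ballWeight, ballWeight, ballWeight, ← ENNReal.ofReal_mul (Real.exp_pos _).le, ← Real.exp_add]
  congr 2
  push_cast
  ring

theorem ballWeight_eq_pow (s : ℝ≥0) (n : ℕ) : ballWeight s n = ballWeight s 1 ^ n := by
  induction n with
  | zero => simp [ballWeight]
  | succ n ih => rw [ballWeight_add_right, ih, pow_succ]

theorem ballWeight_antitone (s : ℝ≥0) : Antitone (ballWeight s) := by
  intro m n h
  refine ENNReal.ofReal_le_ofReal (Real.exp_le_exp.2 (neg_le_neg ?_))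
  gcongr

theorem ballWeight_one_lt_one {s : ℝ≥0} (hs : 0 < s) : ballWeight s 1 < 1 := by
  simpa [ballWeight] using hs

/-- The weights `exp(-δ n)` can be scaled to have an arbitrarily small sum. -/
theorem exists_mul_tsum_ballWeight_lt {δ : ℝ≥0} (hδ : 0 < δ) {c : ℝ≥0∞} (hc : c ≠ 0) :
    ∃ κ : ℝ≥0∞, κ ≠ 0 ∧ ∑' n, κ * ballWeight δ n < c := by
  have h1 : 1 - ballWeight δ 1 ≠ 0 := (tsub_pos_of_lt (ballWeight_one_lt_one hδ)).ne'
  have hS : ∑' n, ballWeight δ n ≠ ∞ := by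
    rw [tsum_congr (ballWeight_eq_pow δ), ENNReal.tsum_geometric]
    exact ENNReal.inv_ne_top.2 h1
  obtain ⟨κ, hκ, h⟩ := ENNReal.exists_nnreal_pos_mul_lt hS hc
  exact ⟨κ, by exact_mod_cast hκ.ne', by rwa [ENNReal.tsum_mul_left]⟩

end Weights

/-! ### Geometry of Bowen balls -/

section BowenBalls

variable {X Y : Type*} [MetricSpace X] [MetricSpace Y]

theorem mem_bowenBall_self (T : X → X) (n : ℕ) (x : X) {ε : ℝ} (hε : 0 < ε) :
    x ∈ bowenBall T n x ε := by
  rw [mem_bowenBall_iff T n x x hε]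
  intro k _
  rwa [dist_self]

theorem mem_bowenBall_comm (T : X → X) (n : ℕ) (x y : X) (ε : ℝ) :
    x ∈ bowenBall T n y ε ↔ y ∈ bowenBall T n x ε := by
  simp only [bowenBall, bowenDist, mem_ofPred_eq, dist_comm]

theorem mem_bowenBall_triangle {T : X → X} {n : ℕ} {x y z : X} {ε η : ℝ} (hε : 0 < ε) (hη : 0 < η)
    (hx : x ∈ bowenBall T n z ε) (hy : y ∈ bowenBall T n z η) : y ∈ bowenBall T n x (ε + η) := by
  rw [mem_bowenBall_iff _ _ _ _ (by positivity)] at *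
  intro k hk
  have := dist_triangle_left (T^[k] x) (T^[k] y) (T^[k] z)
  linarith [hx k hk, hy k hk]

theorem isOpen_bowenBall {T : X → X} (hT : Continuous T) (n : ℕ) (x : X) {ε : ℝ} (hε : 0 < ε) :
    IsOpen (bowenBall T n x ε) := by
  have : bowenBall T n x ε = ⋂ k ∈ Finset.range n, {y | dist (T^[k] x) (T^[k] y) < ε} := by
    ext y
    simp [mem_bowenBall_iff T n x y hε]
  rw [this]
  exact isOpen_biInter_finset fun k _ =>
    isOpen_lt (continuous_const.dist (hT.iterate k)) continuous_const

/-- The maximum metric makes Bowen balls of the product system products of balls of the same order.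
-/
theorem mem_bowenBall_prodMap (T : X → X) (S : Y → Y) (n : ℕ) (p q : X × Y) {ε : ℝ} (hε : 0 < ε) :
    q ∈ bowenBall (Prod.map T S) n p ε ↔
      q.1 ∈ bowenBall T n p.1 ε ∧ q.2 ∈ bowenBall S n p.2 ε := by
  simp only [mem_bowenBall_iff _ _ _ _ hε, Prod.map_iterate, Prod.dist_eq, Prod.map_fst,
    Prod.map_snd, max_lt_iff, forall_and]

end BowenBalls

/-! ### Cover sums and semiconjugacies -/

section CoverSums

variable {X Y : Type*} [MetricSpace X] [MetricSpace Y]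

/-- The cover sum is bounded by the sum over any countably indexed cover, repetitions allowed. -/
theorem coverSum_le_tsum {ι : Type*} [Countable ι] (T : X → X) (s : ℝ≥0) {N : ℕ} {ε : ℝ} {Z : Set X}
    (x : ι → X) (n : ι → ℕ) (hN : ∀ i, N ≤ n i) (hZ : ∀ z ∈ Z, ∃ i, z ∈ bowenBall T (n i) (x i) ε) :
    coverSum T s N ε Z ≤ ∑' i, ballWeight s (n i) := by
  let f : ι → X × ℕ := fun i => (x i, n i)
  refine (iInf₂_le_of_le (range f) (countable_range f) (iInf₂_le_of_le ?_ ?_ le_rfl)).trans ?_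
  · rintro _ ⟨i, rfl⟩
    exact hN i
  · intro z hz
    obtain ⟨i, hi⟩ := hZ z hz
    exact mem_biUnion (mem_range_self i) hi
  · exact ENNReal.tsum_le_tsum_comp_of_surjective (f := rangeFactorization f)
      rangeFactorization_surjective fun p => ballWeight s (p : X × ℕ).2

theorem le_coverSum (T : X → X) (s : ℝ≥0) {N : ℕ} {ε : ℝ} {Z : Set X} {c : ℝ≥0∞}
    (h : ∀ C : Set (X × ℕ), C.Countable → (∀ p ∈ C, N ≤ p.2) →
      (∀ z ∈ Z, ∃ p ∈ C, z ∈ bowenBall T p.2 p.1 ε) →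
      c ≤ ∑' p : C, ballWeight s (p : X × ℕ).2) : c ≤ coverSum T s N ε Z :=
  le_iInf fun C => le_iInf fun h1 => le_iInf fun h2 => le_iInf fun h3 =>
    h C h1 h2 fun z hz => by simpa using h3 hz

theorem exists_cover_of_coverSum_lt {T : X → X} {s : ℝ≥0} {N : ℕ} {ε : ℝ} {Z : Set X} {c : ℝ≥0∞}
    (h : coverSum T s N ε Z < c) :
    ∃ C : Set (X × ℕ), C.Countable ∧ (∀ p ∈ C, N ≤ p.2) ∧ (Z ⊆ ⋃ p ∈ C, bowenBall T p.2 p.1 ε) ∧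
      ∑' p : C, ballWeight s (p : X × ℕ).2 < c := by
  simp only [coverSum, iInf_lt_iff] at h
  obtain ⟨C, h1, h2, h3, h4⟩ := h
  exact ⟨C, h1, h2, h3, h4⟩

theorem coverMeasure_eq_zero_iff {T : X → X} {s : ℝ≥0} {Z : Set X} :
    coverMeasure T s Z = 0 ↔ ∀ ε : ℝ, 0 < ε → ∀ N, coverSum T s N ε Z = 0 := by
  simp only [coverMeasure, coverMeasureAt, ENNReal.iSup_eq_zero]

theorem bowenEntropy_le_of_coverMeasure_eq_zero {T : X → X} {s : ℝ≥0} {Z : Set X}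
    (h : coverMeasure T s Z = 0) : bowenEntropy T Z ≤ s :=
  iInf₂_le (f := fun (s : ℝ≥0) (_ : coverMeasure T s Z = 0) => (s : ℝ≥0∞)) s h

/-- A `1`-Lipschitz semiconjugacy does not increase cover sums. -/
theorem coverSum_le_of_semiconj {T : X → X} {S : Y → Y} {φ : X → Y} (hφ : Function.Semiconj φ T S)
    (hd : ∀ x y, dist (φ x) (φ y) ≤ dist x y) {Z : Set X} {W : Set Y} (hW : W ⊆ φ '' Z) (s : ℝ≥0)
    (N : ℕ) {ε : ℝ} (hε : 0 < ε) : coverSum S s N ε W ≤ coverSum T s N ε Z := by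
  refine le_coverSum T s fun C hC hN hZ => ?_
  have := hC.to_subtype
  refine coverSum_le_tsum S s (fun p : C => φ (p : X × ℕ).1) _ (fun p => hN p p.2) ?_
  intro w hw
  obtain ⟨z, hz, rfl⟩ := hW hw
  obtain ⟨p, hp, hzp⟩ := hZ z hz
  refine ⟨⟨p, hp⟩, ?_⟩
  rw [mem_bowenBall_iff _ _ _ _ hε] at hzp ⊢
  intro k hk
  rw [← (hφ.iterate_right k).eq, ← (hφ.iterate_right k).eq]
  exact (hd _ _).trans_lt (hzp k hk)

/-- A `1`-Lipschitz semiconjugacy does not increase the Bowen entropy. -/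
theorem bowenEntropy_le_of_semiconj {T : X → X} {S : Y → Y} {φ : X → Y}
    (hφ : Function.Semiconj φ T S) (hd : ∀ x y, dist (φ x) (φ y) ≤ dist x y) {Z : Set X} {W : Set Y}
    (hW : W ⊆ φ '' Z) : bowenEntropy S W ≤ bowenEntropy T Z := by
  refine le_iInf₂ fun s hs => bowenEntropy_le_of_coverMeasure_eq_zero ?_
  rw [coverMeasure_eq_zero_iff] at hs ⊢
  exact fun ε hε N => nonpos_iff_eq_zero.1
    ((coverSum_le_of_semiconj hφ hd hW s N hε).trans (hs ε hε N).le)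

variable (T : X → X) (S : Y → Y) (Z : Set X) (W : Set Y)

/-- The two projection bounds settle the lower bound when one factor has entropy `0`, where no
exponent lies strictly below the entropy. -/
theorem bowenEntropy_le_prod_left (hW : W.Nonempty) :
    bowenEntropy T Z ≤ bowenEntropy (Prod.map T S) (Z ×ˢ W) :=
  bowenEntropy_le_of_semiconj (φ := Prod.fst) (fun _ => rfl) (fun _ _ => le_max_left _ _)
    (fst_image_prod Z hW).ge

theorem bowenEntropy_le_prod_right (hZ : Z.Nonempty) :
    bowenEntropy S W ≤ bowenEntropy (Prod.map T S) (Z ×ˢ W) :=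
  bowenEntropy_le_of_semiconj (φ := Prod.snd) (fun _ => rfl) (fun _ _ => le_max_right _ _)
    (snd_image_prod hZ W).ge

/-- The flip is an isometry; it allows the compact invariant factor to be taken second. -/
theorem bowenEntropy_prod_swap_le :
    bowenEntropy (Prod.map S T) (W ×ˢ Z) ≤ bowenEntropy (Prod.map T S) (Z ×ˢ W) := by
  have hd : ∀ x y : X × Y, dist x.swap y.swap ≤ dist x y := fun x y => by
    rw [Prod.dist_eq, Prod.dist_eq, max_comm, Prod.fst_swap, Prod.fst_swap, Prod.snd_swap,
      Prod.snd_swap]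
  have hφ : Function.Semiconj Prod.swap (Prod.map T S) (Prod.map S T) := fun _ => rfl
  exact bowenEntropy_le_of_semiconj hφ hd (image_swap_prod Z W).ge

end CoverSums

/-! ### Lower bound: weighted covers and slicing -/

section LowerBound

variable {X Y : Type*} [MetricSpace X] [MetricSpace Y]

/-- A maximal subset of `A` no point of which lies in the Bowen ball of another one. -/
theorem exists_maximal_separated (T : X → X) (n : ℕ) {ε : ℝ} (hε : 0 < ε) (A : Set X) :
    ∃ E ⊆ A, (E.Pairwise fun x y => y ∉ bowenBall T n x ε) ∧
      ∀ z ∈ A, ∃ x ∈ E, z ∈ bowenBall T n x ε := by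
  obtain ⟨E, hE⟩ := zorn_subset
    {E : Set X | E ⊆ A ∧ E.Pairwise fun x y => y ∉ bowenBall T n x ε} fun c hc hch =>
      ⟨⋃₀ c, ⟨sUnion_subset fun s hs => (hc hs).1,
        hch.pairwise_sUnion.2 fun s hs => (hc hs).2⟩, fun s hs => subset_sUnion_of_mem hs⟩
  refine ⟨E, hE.prop.1, hE.prop.2, fun z hz => ?_⟩
  by_contra! h
  have hins : insert z E ⊆ E := hE.le_of_ge ⟨insert_subset hz hE.prop.1,
    hE.prop.2.insert fun x hx _ =>
      ⟨fun hxz => h x hx ((mem_bowenBall_comm ..).1 hxz), h x hx⟩⟩ (subset_insert z E)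
  exact h z (hins (mem_insert z E)) (mem_bowenBall_self T n z hε)

/-- Points lying in weighted Bowen balls of order `n` of total weight at least `a` can be covered
by at most `(∑ w) / a` Bowen balls of order `n` and twice the radius. -/
theorem exists_countable_cover_of_weights {ι : Type*} (T : X → X) (n : ℕ) {ε : ℝ} (hε : 0 < ε)
    (x : ι → X) (w : ι → ℝ≥0∞) (hw : ∑' i, w i ≠ ∞) {a : ℝ≥0∞} (ha : a ≠ 0) {A : Set X}
    (hA : ∀ z ∈ A, a ≤ ∑' i, (bowenBall T n (x i) ε).indicator (fun _ => w i) z) :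
    ∃ E ⊆ A, E.Countable ∧ (∀ z ∈ A, ∃ y ∈ E, z ∈ bowenBall T n y (ε + ε)) ∧
      ∑' _ : E, a ≤ ∑' i, w i := by
  -- Separation at scale `2ε` leaves at most one point of `E` in each ball of radius `ε`, so double
  -- counting charges each `w i` at most once.
  obtain ⟨E, hEA, hsep, hcov⟩ := exists_maximal_separated T n (add_pos hε hε) A
  have hle : ∑' _ : E, a ≤ ∑' i, w i :=
    calc ∑' _ : E, a
        ≤ ∑' y : E, ∑' i, (bowenBall T n (x i) ε).indicator (fun _ => w i) (y : X) :=
          ENNReal.tsum_le_tsum fun y => hA y (hEA y.2)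
      _ = ∑' i, ∑' y : E, (bowenBall T n (x i) ε).indicator (fun _ => w i) (y : X) :=
          ENNReal.tsum_comm
      _ ≤ ∑' i, w i := by
          refine ENNReal.tsum_le_tsum fun i => ?_
          by_cases hi : ∃ y : E, (y : X) ∈ bowenBall T n (x i) ε
          · obtain ⟨y, hy⟩ := hi
            rw [tsum_eq_single y fun y' hne => indicator_of_notMem (fun hy' => ?_) _]
            · exact indicator_le_self _ _ _
            · exact hsep y.2 y'.2 (fun h => hne (Subtype.ext h.symm))
                (mem_bowenBall_triangle hε hε hy hy')
          · push Not at hi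
            simp [indicator_of_notMem (hi _)]
  refine ⟨E, hEA, ?_, hcov, hle⟩
  -- A nonzero constant has a finite sum over `E`, so `E` is countable.
  have := Summable.countable_support_ennreal (ne_top_of_le_ne_top hw hle)
  rw [Function.support_const ha, countable_univ_iff] at this
  exact this

/-- Weighted covers by Bowen balls are no more efficient than covers, up to doubling the radius,
an arbitrarily small increase of the exponent and a constant factor. -/
theorem coverSum_mul_le_tsum_weights {ι : Type*} (T : X → X) {s δ : ℝ≥0} {N : ℕ} {ε : ℝ}
    (hε : 0 < ε) {Z : Set X} (x : ι → X) (n : ι → ℕ) (hN : ∀ i, N ≤ n i) (w : ι → ℝ≥0∞)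
    {c κ : ℝ≥0∞} (hκ : κ ≠ 0) (hκc : ∑' m, κ * ballWeight δ m < c)
    (hw : ∀ z ∈ Z, c ≤ ∑' i, (bowenBall T (n i) (x i) ε).indicator (fun _ => w i) z) :
    coverSum T (s + δ) N (ε + ε) Z * κ ≤ ∑' i, w i * ballWeight s (n i) := by
  classical
  by_cases htop : ∑' i, w i * ballWeight s (n i) = ∞
  · simp [htop]
  let g : ℕ → ι → ℝ≥0∞ := fun m i => if m = n i then w i else 0
  have hg : ∀ m, ballWeight s m * ∑' i, g m i = ∑' i, if m = n i then w i * ballWeight s (n i)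
      else 0 := fun m => by
    rw [← ENNReal.tsum_mul_left]
    refine tsum_congr fun i => ?_
    by_cases h : m = n i
    · simp [g, h, mul_comm]
    · simp [g, h]
  have hgsum : ∑' m, ballWeight s m * ∑' i, g m i = ∑' i, w i * ballWeight s (n i) := by
    rw [tsum_congr hg, ENNReal.tsum_comm]
    exact tsum_congr fun i => tsum_ite_eq (n i) fun _ => w i * ballWeight s (n i)
  have hgtop : ∀ m, ∑' i, g m i ≠ ∞ := fun m h => htop <| by
    rw [← hgsum]
    refine ENNReal.tsum_eq_top_of_eq_top ⟨m, ?_⟩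
    rw [h, ENNReal.mul_top (ballWeight_ne_zero s m)]
  have ha : ∀ m, κ * ballWeight δ m ≠ 0 := fun m => mul_ne_zero hκ (ballWeight_ne_zero δ m)
  -- Points that receive at least `κ exp(-δ m)` from the balls of order exactly `m`.
  let A : ℕ → Set X := fun m => {z ∈ Z | κ * ballWeight δ m ≤
    ∑' i, (bowenBall T m (x i) ε).indicator (fun _ => g m i) z}
  choose E hEA hEc hcov hsum using fun m => exists_countable_cover_of_weights T m hε x (g m)
    (hgtop m) (ha m) (A := A m) fun z hz => hz.2
  -- No ball has order below `N`, so there the level set is empty, its threshold being positive.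
  have hEN : ∀ m, ∀ y ∈ E m, N ≤ m := by
    intro m y hy
    by_contra! hm
    have h0 : ∀ i, g m i = 0 := fun i => if_neg (hm.trans_le (hN i)).ne
    have := (hEA m hy).2
    simp only [h0, indicator_zero, tsum_zero, nonpos_iff_eq_zero] at this
    exact ha m this
  -- Pigeonhole over orders: the thresholds sum to less than `c`, so some order meets its threshold.
  have hZ : ∀ z ∈ Z, ∃ m, z ∈ A m := by
    intro z hz
    by_contra! h
    refine ((hw z hz).trans ?_).not_gt hκc
    calc ∑' i, (bowenBall T (n i) (x i) ε).indicator (fun _ => w i) z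
        = ∑' i, ∑' m, (bowenBall T m (x i) ε).indicator (fun _ => g m i) z := by
          refine tsum_congr fun i => ?_
          rw [tsum_eq_single (n i) fun m hm => by simp [g, hm]]
          simp [g]
      _ = ∑' m, ∑' i, (bowenBall T m (x i) ε).indicator (fun _ => g m i) z := ENNReal.tsum_comm
      _ ≤ ∑' m, κ * ballWeight δ m :=
          ENNReal.tsum_le_tsum fun m => (not_le.1 fun hm => h m ⟨hz, hm⟩).le
  have := fun m => (hEc m).to_subtype
  have hcover := coverSum_le_tsum (ι := Σ m, E m) (N := N) (ε := ε + ε) (Z := Z) T (s + δ)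
    (fun p => p.2) (fun p => p.1) (fun p => hEN p.1 p.2 p.2.2) fun z hz => by
      obtain ⟨m, hm⟩ := hZ z hz
      obtain ⟨y, hy, hzy⟩ := hcov m z hm
      exact ⟨⟨m, y, hy⟩, hzy⟩
  calc coverSum T (s + δ) N (ε + ε) Z * κ
      ≤ (∑' p : Σ m, E m, ballWeight (s + δ) p.1) * κ := by gcongr
    _ = ∑' m, ballWeight s m * ∑' _ : E m, κ * ballWeight δ m := by
        rw [ENNReal.tsum_sigma', ← ENNReal.tsum_mul_right]
        refine tsum_congr fun m => ?_
        rw [← ENNReal.tsum_mul_right, ← ENNReal.tsum_mul_left]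
        refine tsum_congr fun _ => ?_
        rw [ballWeight_add_left]
        ring
    _ ≤ ∑' m, ballWeight s m * ∑' i, g m i := by
        gcongr with m
        exact hsum m
    _ = ∑' i, w i * ballWeight s (n i) := hgsum

/-- Slicing a cover of a product of two sets bounds its sum from below. -/
theorem coverSum_prod_ne_zero (T : X → X) (S : Y → Y) {s t δ : ℝ≥0} (hδ : 0 < δ) {N : ℕ} {ε : ℝ}
    (hε : 0 < ε) {Z : Set X} {W : Set Y} (hZ : coverSum T (s + δ) N (ε + ε) Z ≠ 0)
    (hW : coverSum S t N ε W ≠ 0) : coverSum (Prod.map T S) (s + t) N ε (Z ×ˢ W) ≠ 0 := by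
  obtain ⟨κ, hκ, hκc⟩ := exists_mul_tsum_ballWeight_lt hδ hW
  refine (lt_of_lt_of_le (pos_iff_ne_zero.2 (mul_ne_zero hZ hκ)) ?_).ne'
  refine le_coverSum _ _ fun C hC hN hcov => ?_
  have := hC.to_subtype
  refine (coverSum_mul_le_tsum_weights (ι := C) (s := s) T hε
    (fun p => (p : (X × Y) × ℕ).1.1) (fun p => (p : (X × Y) × ℕ).2) (fun p => hN p p.2)
    (fun p => ballWeight t (p : (X × Y) × ℕ).2) hκ hκc fun z hz => ?_).trans_eq ?_
  · let D : Set C := {p | z ∈ bowenBall T (p : (X × Y) × ℕ).2 (p : (X × Y) × ℕ).1.1 ε}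
    refine (coverSum_le_tsum (ι := D) S t (fun p => (p : (X × Y) × ℕ).1.2)
      (fun p => (p : (X × Y) × ℕ).2) (fun p => hN _ p.1.2) fun y hy => ?_).trans_eq ?_
    · obtain ⟨p, hp, hzp⟩ := hcov (z, y) ⟨hz, hy⟩
      rw [mem_bowenBall_prodMap _ _ _ _ _ hε] at hzp
      exact ⟨⟨⟨p, hp⟩, hzp.1⟩, hzp.2⟩
    · exact tsum_subtype D fun p : C => ballWeight t (p : (X × Y) × ℕ).2
  · exact tsum_congr fun p => by rw [ballWeight_add_left, mul_comm]

/-- The Bowen entropy of a product of nonempty sets is at least the sum of the entropies. -/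
theorem bowenEntropy_add_le_prod (T : X → X) (S : Y → Y) {Z : Set X} {W : Set Y}
    (hZ : Z.Nonempty) (hW : W.Nonempty) :
    bowenEntropy T Z + bowenEntropy S W ≤ bowenEntropy (Prod.map T S) (Z ×ˢ W) := by
  rcases eq_or_ne (bowenEntropy T Z) 0 with h0 | hZ0
  · rw [h0, zero_add]
    exact bowenEntropy_le_prod_right T S Z W hZ
  rcases eq_or_ne (bowenEntropy S W) 0 with h0 | hW0
  · rw [h0, add_zero]
    exact bowenEntropy_le_prod_left T S Z W hW
  refine le_of_forall_lt fun d hd => ?_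
  obtain ⟨a, ha, b, hb, hab⟩ := ENNReal.exists_lt_add_of_lt_add hd hZ0 hW0
  obtain ⟨s, has, hs⟩ := ENNReal.lt_iff_exists_nnreal_btwn.1 ha
  obtain ⟨t, hbt, ht⟩ := ENNReal.lt_iff_exists_nnreal_btwn.1 hb
  -- The gap `r - s` pays for the exponent loss `δ`; halving `ε₁` below pays for the doubled radius.
  obtain ⟨r, hsr, hr⟩ := ENNReal.lt_iff_exists_nnreal_btwn.1 hs
  refine (hab.trans (ENNReal.add_lt_add has hbt)).trans_le ?_
  by_contra! hlt
  rw [← ENNReal.coe_add] at hlt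
  have h0 := coverMeasure_eq_zero_iff.1 (coverMeasure_eq_zero _ hlt)
  have h1 : coverMeasure T r Z ≠ 0 := by simp [coverMeasure_eq_top T hr]
  have h2 : coverMeasure S t W ≠ 0 := by simp [coverMeasure_eq_top S ht]
  simp only [ne_eq, coverMeasure_eq_zero_iff, not_forall] at h1 h2
  obtain ⟨ε₁, hε₁, N₁, h1⟩ := h1
  obtain ⟨ε₂, hε₂, N₂, h2⟩ := h2
  rw [ENNReal.coe_lt_coe] at hsr
  have hε : 0 < min (ε₁ / 2) ε₂ := lt_min (half_pos hε₁) hε₂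
  refine coverSum_prod_ne_zero T S (δ := r - s) (tsub_pos_of_lt hsr) (N := max N₁ N₂) hε ?_ ?_
    (h0 _ hε _)
  · rw [add_tsub_cancel_of_le hsr.le]
    refine ne_bot_of_le_ne_bot h1 ((coverSum_mono_left T r ε₁ Z (le_max_left N₁ N₂)).trans ?_)
    exact coverSum_antitone T r _ Z (by linarith [min_le_left (ε₁ / 2) ε₂])
  · refine ne_bot_of_le_ne_bot h2 ((coverSum_mono_left S t ε₂ W (le_max_right N₁ N₂)).trans ?_)
    exact coverSum_antitone S t _ W (min_le_right _ _)

end LowerBound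

/-! ### Upper bound: counting orbits in a compact invariant set -/

section UpperBound

variable {X Y : Type*} [MetricSpace X] [MetricSpace Y]

theorem ballWeight_le_one (s : ℝ≥0) (n : ℕ) : ballWeight s n ≤ 1 :=
  (ballWeight_antitone s n.zero_le).trans_eq (by simp [ballWeight])

/-- Points of a Bowen ball of order `m` whose images under `T^m` follow each other for `n - m`
steps follow each other for `n` steps. -/
theorem mem_bowenBall_of_iterate {T : X → X} {n m : ℕ} {x y z : X} {ε : ℝ} (hε : 0 < ε)
    (hx : x ∈ bowenBall T m z (ε / 2)) (hy : y ∈ bowenBall T m z (ε / 2))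
    (hxy : T^[m] y ∈ bowenBall T (n - m) (T^[m] x) ε) : y ∈ bowenBall T n x ε := by
  have h := mem_bowenBall_triangle (half_pos hε) (half_pos hε) hx hy
  rw [add_halves] at h
  rw [mem_bowenBall_iff _ _ _ _ hε] at *
  intro k hk
  rcases lt_or_ge k m with hkm | hkm
  · exact h k hkm
  · have := hxy (k - m) (by lia)
    rwa [← Function.iterate_add_apply, ← Function.iterate_add_apply, Nat.sub_add_cancel hkm] at this

/-- A compact invariant set on which the cover measure of exponent `t` vanishes is covered, for
each `n`, by a constant times `exp(t n)` sets of small `n`-th Bowen diameter. -/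
theorem exists_finset_cover_of_invariant {T : X → X} (hT : Continuous T) {Z : Set X}
    (hZ : IsCompact Z) (hinv : MapsTo T Z Z) {t : ℝ≥0} (ht : coverMeasure T t Z = 0) {ε : ℝ}
    (hε : 0 < ε) :
    ∃ C : ℝ≥0∞, C ≠ ∞ ∧ ∀ n, ∃ 𝓐 : Finset (Set X), (∀ z ∈ Z, ∃ A ∈ 𝓐, z ∈ A) ∧
      (∀ A ∈ 𝓐, ∀ x ∈ A, ∀ y ∈ A, y ∈ bowenBall T n x ε) ∧ 𝓐.card * ballWeight t n ≤ C := by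
  classical
  -- Orders at least `1` make the recursion from `n` to `n - p.2` decrease; radius `ε / 2` makes any
  -- two points of a ball `ε`-close.
  have h01 : coverSum T t 1 (ε / 2) Z < 1 := by
    rw [coverMeasure_eq_zero_iff.1 ht _ (half_pos hε)]
    exact one_pos
  obtain ⟨D, -, hD1, hDZ, hDsum⟩ := exists_cover_of_coverSum_lt h01
  obtain ⟨F', hF'D, hfin, hF'Z⟩ := hZ.elim_finite_subcover_image
    (fun p _ => isOpen_bowenBall hT p.2 p.1 (half_pos hε)) hDZ
  lift F' to Finset (X × ℕ) using hfin
  have hFsum : ∑ p ∈ F', ballWeight t p.2 ≤ 1 := by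
    rw [← Finset.tsum_subtype' F' fun p => ballWeight t p.2]
    exact (ENNReal.tsum_mono_subtype (fun p : X × ℕ => ballWeight t p.2) hF'D).trans hDsum.le
  obtain ⟨M, hM⟩ : ∃ M, ∀ p ∈ F', p.2 ≤ M := ⟨F'.sup Prod.snd, fun p hp => Finset.le_sup hp⟩
  -- The constant `exp(t M)` absorbs the base case `n ≤ p.2 ≤ M`, where a single set suffices and `C
  -- * ballWeight t p.2 ≥ 1`.
  refine ⟨(ballWeight t M)⁻¹, ENNReal.inv_ne_top.2 (ballWeight_ne_zero t M), fun n => ?_⟩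
  set C := (ballWeight t M)⁻¹ with hC
  induction n using Nat.strong_induction_on with
  | _ n ih =>
  have hstep : ∀ p ∈ F', ∃ 𝓑 : Finset (Set X), (∀ z ∈ Z, ∃ B ∈ 𝓑, z ∈ B) ∧
      (∀ B ∈ 𝓑, ∀ x ∈ B, ∀ y ∈ B, y ∈ bowenBall T (n - p.2) x ε) ∧
      𝓑.card * ballWeight t n ≤ C * ballWeight t p.2 := by
    intro p hp
    rcases le_or_gt n p.2 with hn | hn
    · refine ⟨{univ}, fun z _ => ⟨univ, by simp⟩, fun B _ x _ y _ => ?_, ?_⟩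
      · rw [Nat.sub_eq_zero_of_le hn, mem_bowenBall_iff _ _ _ _ hε]
        simp
      · rw [Finset.card_singleton, Nat.cast_one, one_mul]
        refine (ballWeight_le_one t n).trans ?_
        rw [← ENNReal.inv_mul_cancel (ballWeight_ne_zero t M) (ballWeight_ne_top t M)]
        gcongr
        exact ballWeight_antitone t (hM p hp)
    · have hp1 := hD1 p (hF'D hp)
      obtain ⟨𝓑, h1, h2, h3⟩ := ih (n - p.2) (by lia)
      refine ⟨𝓑, h1, h2, ?_⟩
      conv_lhs => rw [← Nat.sub_add_cancel hn.le, ballWeight_add_right, ← mul_assoc]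
      gcongr
  choose! 𝓑 hcov hdiam hcard using hstep
  -- Follow the ball of `p` for `p.2` steps, then a set of the cover for the remaining time. The
  -- bound `C` reproduces itself because the weights over `F'` sum to at most `1`.
  refine ⟨F'.biUnion fun p => (𝓑 p).image fun B => bowenBall T p.2 p.1 (ε / 2) ∩ T^[p.2] ⁻¹' B,
    fun z hz => ?_, fun A hA x hx y hy => ?_, ?_⟩
  · obtain ⟨p, hp, hzp⟩ := mem_iUnion₂.1 (hF'Z hz)
    obtain ⟨B, hB, hzB⟩ := hcov p hp _ (hinv.iterate p.2 hz)
    exact ⟨_, Finset.mem_biUnion.2 ⟨p, hp, Finset.mem_image_of_mem _ hB⟩, hzp, hzB⟩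
  · obtain ⟨p, hp, hA⟩ := Finset.mem_biUnion.1 hA
    obtain ⟨B, hB, rfl⟩ := Finset.mem_image.1 hA
    exact mem_bowenBall_of_iterate hε hx.1 hy.1 (hdiam p hp B hB _ hx.2 _ hy.2)
  · calc _ ≤ ((∑ p ∈ F', (𝓑 p).card : ℕ) : ℝ≥0∞) * ballWeight t n := by
          gcongr
          exact Finset.card_biUnion_le.trans (Finset.sum_le_sum fun p _ => Finset.card_image_le)
      _ = ∑ p ∈ F', (𝓑 p).card * ballWeight t n := by push_cast; rw [Finset.sum_mul]
      _ ≤ ∑ p ∈ F', C * ballWeight t p.2 := Finset.sum_le_sum hcard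
      _ ≤ C := by
          rw [← Finset.mul_sum]
          exact mul_le_of_le_one_right' hFsum

/-- A compact invariant set on which the cover measure of exponent `t` vanishes is covered, for
each `n`, by a constant times `exp(t n)` Bowen balls of order `n`. -/
theorem exists_finset_centers_of_invariant {T : X → X} (hT : Continuous T) {Z : Set X}
    (hZ : IsCompact Z) (hinv : MapsTo T Z Z) {t : ℝ≥0} (ht : coverMeasure T t Z = 0) {ε : ℝ}
    (hε : 0 < ε) :
    ∃ C : ℝ≥0∞, C ≠ ∞ ∧ ∀ n, ∃ F : Finset X, (∀ z ∈ Z, ∃ y ∈ F, z ∈ bowenBall T n y ε) ∧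
      F.card * ballWeight t n ≤ C := by
  classical
  obtain ⟨C, hC, h⟩ := exists_finset_cover_of_invariant hT hZ hinv ht hε
  refine ⟨C, hC, fun n => ?_⟩
  obtain ⟨𝓐, hcov, hdiam, hcard⟩ := h n
  rcases Z.eq_empty_or_nonempty with rfl | ⟨z₀, -⟩
  · exact ⟨∅, by simp⟩
  -- The point `z₀` is only a default for empty members of the cover.
  refine ⟨𝓐.image fun A => if hA : A.Nonempty then hA.some else z₀, fun z hz => ?_,
    le_trans (by gcongr; exact Finset.card_image_le) hcard⟩
  obtain ⟨A, hA, hzA⟩ := hcov z hz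
  refine ⟨_, Finset.mem_image_of_mem _ hA, ?_⟩
  have hne : A.Nonempty := ⟨z, hzA⟩
  rw [dif_pos hne]
  exact hdiam A hA _ hne.some_mem z hzA

/-- The cover measure of a product with a compact invariant factor. -/
theorem coverMeasure_prod_eq_zero {T : X → X} {S : Y → Y} (hS : Continuous S) {Z : Set X}
    {W : Set Y} (hW : IsCompact W) (hinv : MapsTo S W W) {s t : ℝ≥0} (hs : coverMeasure T s Z = 0)
    (ht : coverMeasure S t W = 0) : coverMeasure (Prod.map T S) (s + t) (Z ×ˢ W) = 0 := by
  refine coverMeasure_eq_zero_iff.2 fun ε hε N => ?_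
  obtain ⟨C, hC, h⟩ := exists_finset_centers_of_invariant hS hW hinv ht hε
  choose F hcov hcard using h
  suffices hle : coverSum (Prod.map T S) (s + t) N ε (Z ×ˢ W) * C⁻¹ ≤ coverSum T s N ε Z by
    rw [coverMeasure_eq_zero_iff.1 hs ε hε N, nonpos_iff_eq_zero, mul_eq_zero] at hle
    exact hle.resolve_right (ENNReal.inv_ne_zero.2 hC)
  refine le_coverSum T s fun D hD hN hDcov => ?_
  have := hD.to_subtype
  rw [← div_eq_mul_inv]
  refine ENNReal.div_le_of_le_mul ?_
  -- Each ball of order `p.2` is paired with a cover of `W` of that same order, so the products are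
  -- Bowen balls.
  refine (coverSum_le_tsum (ι := Σ p : D, F (p : X × ℕ).2) (Prod.map T S) (s + t)
    (fun q => ((q.1 : X × ℕ).1, (q.2 : Y))) (fun q => (q.1 : X × ℕ).2)
    (fun q => hN q.1 q.1.2) ?_).trans ?_
  · rintro ⟨z, w⟩ ⟨hz, hw⟩
    obtain ⟨p, hp, hzp⟩ := hDcov z hz
    obtain ⟨y, hy, hwy⟩ := hcov p.2 w hw
    exact ⟨⟨⟨p, hp⟩, y, hy⟩, (mem_bowenBall_prodMap _ _ _ _ _ hε).2 ⟨hzp, hwy⟩⟩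
  · rw [ENNReal.tsum_sigma', ← ENNReal.tsum_mul_right]
    refine ENNReal.tsum_le_tsum fun p => ?_
    dsimp only
    rw [tsum_fintype, Finset.sum_const, Finset.card_univ, Fintype.card_coe, nsmul_eq_mul,
      ballWeight_add_left, mul_left_comm]
    gcongr
    exact hcard _

/-- The Bowen entropy of a product with a compact invariant factor is at most the sum of the
entropies. -/
theorem bowenEntropy_prod_le_add {T : X → X} {S : Y → Y} (hS : Continuous S) {Z : Set X}
    {W : Set Y} (hW : IsCompact W) (hinv : MapsTo S W W) :
    bowenEntropy (Prod.map T S) (Z ×ˢ W) ≤ bowenEntropy T Z + bowenEntropy S W := by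
  conv_rhs => rw [bowenEntropy, bowenEntropy]
  refine ENNReal.le_iInf₂_add_iInf₂ fun s hs t ht => ?_
  rw [← ENNReal.coe_add]
  exact bowenEntropy_le_of_coverMeasure_eq_zero (coverMeasure_prod_eq_zero hS hW hinv hs ht)

end UpperBound

end BowenEntropy

theorem mainTheorem4 {X₁ X₂ : Type*} [MetricSpace X₁] [CompactSpace X₁]
    [MetricSpace X₂] [CompactSpace X₂]
    (T₁ : X₁ → X₁) (hT₁ : Continuous T₁) (T₂ : X₂ → X₂) (hT₂ : Continuous T₂)
    (Z₁ : Set X₁) (Z₂ : Set X₂)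
    (hZ₁ : MeasureTheory.AnalyticSet Z₁) (hZ₂ : MeasureTheory.AnalyticSet Z₂)
    (hne₁ : Z₁.Nonempty) (hne₂ : Z₂.Nonempty)
    (hinv : (IsCompact Z₁ ∧ Set.MapsTo T₁ Z₁ Z₁) ∨ (IsCompact Z₂ ∧ Set.MapsTo T₂ Z₂ Z₂)) :
    BowenEntropy.bowenEntropy (Prod.map T₁ T₂) (Z₁ ×ˢ Z₂) =
      BowenEntropy.bowenEntropy T₁ Z₁ + BowenEntropy.bowenEntropy T₂ Z₂ := by
  refine le_antisymm ?_ (BowenEntropy.bowenEntropy_add_le_prod T₁ T₂ hne₁ hne₂)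
  rcases hinv with ⟨hc, hm⟩ | ⟨hc, hm⟩
  · rw [add_comm]
    exact (BowenEntropy.bowenEntropy_prod_swap_le T₂ T₁ Z₂ Z₁).trans
      (BowenEntropy.bowenEntropy_prod_le_add hT₁ hc hm)
  · exact BowenEntropy.bowenEntropy_prod_le_add hT₂ hc hm
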